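/- Let $R$ be an integral domain with quotient field $K$. For a nonzero ideal $I$ of $R$ put $I^{-1}=\{x\in K : xI\subseteq R\}$ and $I_v=(I^{-1})^{-1}$ (the same formula defining the inverse of the fractional ideal $I^{-1}$), and call $I$ divisorial if $I=I_v$; call $R$ a Mori domain if it satisfies the ascending chain condition on divisorial ideals of $R$. Call $R$ an sQQR-domain if for every $u\in K$ the ring $R[u]$ is an intersection of localizations of $R$, that is, $R[u]=\bigcap_{P\in\mathcal P}R_P$ for some set $\mathcal P$ of prime ideals of $R$. If $R$ is a Mori domain and an sQQR-domain, then $R$ is a Dedekind domain (fields being counted as Dedekind domains). -/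

import Mathlib

open scoped nonZeroDivisors

/-- An ideal `I` of a domain `R` with quotient field `K` is divisorial if `I = I_v`, where
`I_v = (I⁻¹)⁻¹` and `J⁻¹ = {x ∈ K | x J ⊆ R}`. (With Mathlib's convention `0⁻¹ = 0` the zero
ideal is divisorial too.) -/
def IsDivisorialIdeal {R : Type*} [CommRing R] [IsDomain R] (K : Type*) [Field K] [Algebra R K]
    [IsFractionRing R K] (I : Ideal R) : Prop :=
  ((I : FractionalIdeal R⁰ K)⁻¹)⁻¹ = (I : FractionalIdeal R⁰ K)

/-- A Mori domain: a domain with the ascending chain condition on (integral) divisorial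
ideals. -/
def IsMoriDomain (R : Type*) [CommRing R] [IsDomain R] (K : Type*) [Field K] [Algebra R K]
    [IsFractionRing R K] : Prop :=
  WellFoundedGT {I : Ideal R // IsDivisorialIdeal K I}

/-- The localization `R_P = {a / s | a ∈ R, s ∈ R \ P}` of a domain `R` at a prime ideal `P`,
as a subring of the quotient field `K` containing `R`. -/
noncomputable def localizationIn {R : Type*} [CommRing R] [IsDomain R] (K : Type*) [Field K]
    [Algebra R K] [IsFractionRing R K] (P : PrimeSpectrum R) : Subalgebra R K :=
  Localization.subalgebra.ofField K P.asIdeal.primeCompl P.asIdeal.primeCompl_le_nonZeroDivisors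

/-- An sQQR-domain: a domain `R` with quotient field `K` each of whose simple overrings `R[u]`,
`u ∈ K`, is an intersection of localizations of `R` at prime ideals. -/
def IsSQQRDomain (R : Type*) [CommRing R] [IsDomain R] (K : Type*) [Field K] [Algebra R K]
    [IsFractionRing R K] : Prop :=
  ∀ u : K, ∃ S : Set (PrimeSpectrum R),
    Algebra.adjoin R {u} = ⨅ P ∈ S, localizationIn K P

open Polynomial

/-! ### Denominator ideals and roots over integrally closed domains. -/

section CommRing

variable {R : Type*} [CommRing R] {K : Type*} [Field K] [Algebra R K]

/-! The crux is that `R` is integrally closed. Otherwise the Mori condition gives an integral `u ∉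
R` with `P = (R : u)` prime. For `T = R[u]`, lying over gives `PT ⊆ P` and sQQR gives `(T : P) = T`.
For `0 ≠ a ∈ P`, prime avoidance yields `c ∈ P` regular modulo `aT` (`exists_regular_pair`). Then `w
= c/a` is not in `R_P`, so sQQR forces `u ∈ R[w]`; regularity puts `u` in `R + cT`, and `cT ⊆ P`, so
`u ∈ R`, a contradiction.

Integral closedness gives `w ∈ R[w²]` for all `w`, so every `R_M` is a valuation ring and nonzero
finitely generated ideals are invertible, hence divisorial. The Mori condition then makes `R`
Noetherian. -/

/-- The ideal of all `r ∈ R` with `r Y ⊆ R`. -/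
def denominatorIdeal (R : Type*) [CommRing R] {K : Type*} [Field K] [Algebra R K] (Y : Set K) :
    Ideal R where
  carrier := {r | ∀ y ∈ Y, algebraMap R K r * y ∈ (algebraMap R K).range}
  zero_mem' := fun y _ => by simp [zero_mem]
  add_mem' := fun {r s} hr hs y hy => by
    rw [map_add, add_mul]
    exact add_mem (hr y hy) (hs y hy)
  smul_mem' := fun c r hr y hy => by
    rw [smul_eq_mul, map_mul, mul_assoc]
    exact mul_mem ⟨c, rfl⟩ (hr y hy)

theorem mem_denominatorIdeal {Y : Set K} {r : R} :
    r ∈ denominatorIdeal R Y ↔ ∀ y ∈ Y, algebraMap R K r * y ∈ (algebraMap R K).range :=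
  Iff.rfl

theorem pow_natDegree_mul_aeval_div_mem_range {a c : R} (ha : algebraMap R K a ≠ 0) (g : R[X]) :
    algebraMap R K a ^ g.natDegree * aeval (algebraMap R K c / algebraMap R K a) g ∈
      (algebraMap R K).range := by
  rw [aeval_eq_sum_range, Finset.mul_sum]
  refine sum_mem fun i hi => ⟨g.coeff i * c ^ i * a ^ (g.natDegree - i), ?_⟩
  have hi' : i ≤ g.natDegree := Nat.lt_succ_iff.mp (Finset.mem_range.mp hi)
  have hpow : algebraMap R K a ^ g.natDegree =
      algebraMap R K a ^ (g.natDegree - i) * algebraMap R K a ^ i := by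
    rw [← pow_add, Nat.sub_add_cancel hi']
  rw [hpow, Algebra.smul_def, map_mul, map_mul, map_pow, map_pow, div_pow]
  field_simp

/-- The `u, u⁻¹` lemma: over an integrally closed domain a root of a polynomial with some
coefficient outside of a prime ideal `M` lies in `R_M` or has its inverse there. -/
theorem exists_notMem_mul_eq_of_aeval_eq_zero
    [IsFractionRing R K] (hint : ∀ x : K, IsIntegral R x → x ∈ (algebraMap R K).range)
    (M : Ideal R) (w : K) (n : ℕ) (f : R[X]) (hn : f.natDegree ≤ n) (hf : aeval w f = 0) (i : ℕ) (hi : f.coeff i ∉ M) :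
    ∃ s ∉ M, ∃ b : R, algebraMap R K s * w = algebraMap R K b ∨
      algebraMap R K b * w = algebraMap R K s := by
  induction n generalizing f i with
  | zero =>
    rw [eq_C_of_natDegree_le_zero hn, aeval_C,
      map_eq_zero_iff _ (IsFractionRing.injective R K)] at hf
    rw [eq_C_of_natDegree_le_zero hn, hf] at hi
    simp at hi
  | succ n ih =>
    have hb : algebraMap R K (f.coeff (n + 1)) * w ∈ (algebraMap R K).range := by
      rcases hn.eq_or_lt with h | h
      · refine hint _ ?_
        rw [← h, ← Algebra.smul_def]
        exact isIntegral_leadingCoeff_smul f w hf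
      · rw [coeff_eq_zero_of_natDegree_lt h]
        simp [zero_mem]
    obtain ⟨b, hb⟩ := hb
    by_cases haM : f.coeff (n + 1) ∈ M
    swap
    · exact ⟨_, haM, b, Or.inl hb.symm⟩
    by_cases hbM : b ∈ M
    swap
    · exact ⟨b, hbM, _, Or.inr hb.symm⟩
    -- Since `b` is the leading coefficient times `w`, folding the top term into degree `n` keeps
    -- the root and changes coefficients only by elements of `M`.
    refine ih (f - C (f.coeff (n + 1)) * X ^ (n + 1) + C b * X ^ n) ?_ ?_ i ?_
    · rw [natDegree_le_iff_coeff_eq_zero]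
      intro N hN
      rcases (Nat.succ_le_of_lt hN).eq_or_lt with rfl | h
      · simp [coeff_X_pow]
      · simp [coeff_X_pow, coeff_eq_zero_of_natDegree_lt (hn.trans_lt h), h.ne', hN.ne']
    · simp only [map_add, map_sub, map_mul, aeval_C, map_pow, aeval_X, hf, hb]
      ring
    · intro h
      refine hi ?_
      simp only [coeff_add, coeff_sub, coeff_C_mul, coeff_X_pow, mul_ite, mul_one, mul_zero] at h
      have h1 : (if i = n + 1 then f.coeff (n + 1) else 0) ∈ M := by split_ifs <;> simp [haM]
      have h2 : (if i = n then b else 0) ∈ M := by split_ifs <;> simp [hbM]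
      have := M.add_mem (M.sub_mem h h2) h1
      simpa using this

end CommRing

/-! ### Divisorial ideals and localizations. -/

section Divisorial

variable {R : Type*} [CommRing R] [IsDomain R] {K : Type*} [Field K] [Algebra R K]
  [IsFractionRing R K]

/-- Both `1` and `Y` lie in `I⁻¹`, so `I_v ⊆ R` and `I_v Y ⊆ R`. -/
theorem isDivisorialIdeal_denominatorIdeal (Y : Set K) :
    IsDivisorialIdeal K (denominatorIdeal R Y) := by
  set I := denominatorIdeal R Y
  unfold IsDivisorialIdeal
  by_cases hI : I = ⊥
  · simp [hI, FractionalIdeal.inv_zero']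
  have h0 : (I : FractionalIdeal R⁰ K) ≠ 0 := FractionalIdeal.coeIdeal_ne_zero.mpr hI
  have h1 : (1 : K) ∈ (I : FractionalIdeal R⁰ K)⁻¹ := FractionalIdeal.one_mem_inv_coe_ideal hI
  have h0' : (I : FractionalIdeal R⁰ K)⁻¹ ≠ 0 := fun h => by
    rw [h, FractionalIdeal.mem_zero_iff] at h1
    exact one_ne_zero h1
  apply le_antisymm
  · intro x hx
    rw [FractionalIdeal.mem_inv_iff h0'] at hx
    obtain ⟨r, hr⟩ := (FractionalIdeal.mem_one_iff _).mp (hx 1 h1)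
    rw [mul_one] at hr
    refine (FractionalIdeal.mem_coeIdeal _).mpr ⟨r, fun y hy => ?_, hr⟩
    have hyI : y ∈ (I : FractionalIdeal R⁰ K)⁻¹ := by
      rw [FractionalIdeal.mem_inv_iff h0]
      intro z hz
      obtain ⟨s, hs, rfl⟩ := (FractionalIdeal.mem_coeIdeal _).mp hz
      obtain ⟨b, hb⟩ := hs y hy
      exact (FractionalIdeal.mem_one_iff _).mpr ⟨b, by rw [hb, mul_comm]⟩
    obtain ⟨b, hb⟩ := (FractionalIdeal.mem_one_iff _).mp (hx y hyI)
    exact ⟨b, by rw [hb, hr]⟩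
  · intro x hx
    rw [FractionalIdeal.mem_inv_iff h0']
    intro y hy
    rw [mul_comm]
    exact (FractionalIdeal.mem_inv_iff h0).mp hy x hx

/-- In a Mori domain every member of a family of divisorial ideals lies below a maximal one. -/
theorem IsMoriDomain.exists_maximal (hMori : IsMoriDomain R K) {F : Set (Ideal R)}
    (hF : ∀ I ∈ F, IsDivisorialIdeal K I) {I : Ideal R} (hI : I ∈ F) :
    ∃ J ∈ F, I ≤ J ∧ ∀ J' ∈ F, J ≤ J' → J' = J := by
  have wf : WellFounded fun I J : {I : Ideal R // IsDivisorialIdeal K I} => J < I := hMori.wf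
  obtain ⟨J, ⟨hJF, hIJ⟩, hJ⟩ := wf.has_min {J | J.1 ∈ F ∧ I ≤ J.1} ⟨⟨I, hF I hI⟩, hI, le_rfl⟩
  refine ⟨J.1, hJF, hIJ, fun J' hJ' hle => ?_⟩
  by_contra hne
  exact hJ ⟨J', hF J' hJ'⟩ ⟨hJ', hIJ.trans hle⟩ 
    (lt_of_le_of_ne hle fun h => hne (congrArg Subtype.val h).symm)

theorem mem_localizationIn {P : PrimeSpectrum R} {x : K} :
    x ∈ localizationIn K P ↔ ∃ s ∉ P.asIdeal, algebraMap R K s * x ∈ (algebraMap R K).range := by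
  have key : x ∈ localizationIn K P ↔ ∃ (a s : R) (_ : s ∈ P.asIdeal.primeCompl),
      x = algebraMap R K a * (algebraMap R K s)⁻¹ := Iff.rfl
  have hne : ∀ s ∉ P.asIdeal, algebraMap R K s ≠ 0 := fun s hs h => by
    rw [map_eq_zero_iff _ (IsFractionRing.injective R K)] at h
    exact hs (h ▸ zero_mem _)
  rw [key]
  constructor
  · rintro ⟨a, s, hs, rfl⟩
    exact ⟨s, hs, a, by field_simp [hne s hs]⟩
  · rintro ⟨s, hs, a, ha⟩
    exact ⟨a, s, hs, by rw [ha, mul_comm, inv_mul_cancel_left₀ (hne s hs)]⟩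

/-- Lying over, for elements integral over `R`. -/
theorem mem_of_isIntegral_mul {P : Ideal R} [P.IsPrime] {m r : R} (hm : m ∈ P) {t : K}
    (ht : IsIntegral R t) (h : algebraMap R K m * t = algebraMap R K r) : r ∈ P := by
  obtain ⟨Q, hQ, hQP⟩ := Ideal.exists_ideal_over_prime_of_isIntegral_of_isDomain
    (S := integralClosure R K) P (by
      rw [(RingHom.injective_iff_ker_eq_bot _).mp
        (FaithfulSMul.algebraMap_injective R (integralClosure R K))]
      exact bot_le)
  have hrm : algebraMap R (integralClosure R K) r =
      algebraMap R (integralClosure R K) m * ⟨t, ht⟩ := Subtype.ext h.symm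
  rw [← hQP, Ideal.mem_comap] at hm ⊢
  rw [hrm]
  exact Q.mul_mem_right _ hm

end Divisorial

/-! ### Mori sQQR-domains are integrally closed. -/

section IntegrallyClosed

variable {R : Type*} [CommRing R] [IsDomain R] {K : Type*} [Field K] [Algebra R K]
  [IsFractionRing R K]

/-- In an sQQR-domain, if `w ∉ R_P`, then `R[w]` contains every `x` with `x P ⊆ R[w]`. -/
theorem IsSQQRDomain.mem_adjoin (hR : IsSQQRDomain R K) {P : Ideal R} {w x : K}
    (hw : ∀ s ∉ P, algebraMap R K s * w ∉ (algebraMap R K).range)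
    (hx : ∀ p ∈ P, algebraMap R K p * x ∈ Algebra.adjoin R {w}) : x ∈ Algebra.adjoin R {w} := by
  obtain ⟨S, hS⟩ := hR w
  have hw' : w ∈ Algebra.adjoin R {w} := Algebra.self_mem_adjoin_singleton R w
  rw [hS] at hx hw' ⊢
  simp only [Algebra.mem_iInf] at hx hw' ⊢
  intro Q hQ
  obtain ⟨s, hs, hsw⟩ := mem_localizationIn.mp (hw' Q hQ)
  -- Thus `P ⊄ Q` whenever `w ∈ R_Q`, and `s ∈ P` is a unit of `R_Q`.
  have hsP : s ∈ P := by_contra fun h => hw s h hsw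
  obtain ⟨t, ht, htx⟩ := mem_localizationIn.mp (hx s hsP Q hQ)
  refine mem_localizationIn.mpr ⟨t * s, fun h => ?_, by rwa [map_mul, mul_assoc]⟩
  exact (Q.isPrime.mem_or_mem h).elim ht hs

/-- Over a Mori domain, an integral element outside of `R` has a multiple whose denominator
ideal is prime. -/
theorem IsMoriDomain.exists_prime_denominatorIdeal (hMori : IsMoriDomain R K) {x : K}
    (hx : IsIntegral R x) (hxR : x ∉ (algebraMap R K).range) :
    ∃ u : K, IsIntegral R u ∧ (denominatorIdeal R {u}).IsPrime := by
  let F : Set (Ideal R) := {I | ∃ r : R, algebraMap R K r * x ∉ (algebraMap R K).range ∧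
    I = denominatorIdeal R {algebraMap R K r * x}}
  obtain ⟨P, ⟨r, hr, rfl⟩, -, hmax⟩ := hMori.exists_maximal (F := F)
    (by rintro _ ⟨r, -, rfl⟩; exact isDivisorialIdeal_denominatorIdeal _)
    ⟨1, by simpa using hxR, rfl⟩
  refine ⟨algebraMap R K r * x, isIntegral_algebraMap.mul hx, ?_, ?_⟩
  · rw [Ideal.ne_top_iff_one, mem_denominatorIdeal]
    simpa using hr
  · intro s t hst
    by_contra! h
    obtain ⟨hs, ht⟩ := h
    refine hs ?_
    rw [mem_denominatorIdeal] at ht hst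
    simp only [Set.mem_singleton_iff, forall_eq] at ht hst
    rw [← hmax (denominatorIdeal R {algebraMap R K (t * r) * x}) ⟨t * r, ?_, rfl⟩ ?_]
    · intro y hy
      rw [Set.mem_singleton_iff.mp hy]
      simpa [mul_assoc] using hst
    · simpa [mul_assoc] using ht
    · intro p hp y hy
      rw [Set.mem_singleton_iff.mp hy]
      have := mul_mem (show algebraMap R K t ∈ (algebraMap R K).range from ⟨t, rfl⟩)
        (hp _ (Set.mem_singleton _))
      rw [map_mul]
      convert this using 1
      ring

/-- If `T = (R : P)` and `(T : P) = T`, then for each nonzero `a` there is `c ∈ P` such that `a y, c y ∈ T` implies `y ∈ T`. -/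
theorem IsMoriDomain.exists_regular_pair (hMori : IsMoriDomain R K) {P : Ideal R}
    {T : Subalgebra R K}
    (hT : ∀ x, x ∈ T ↔ ∀ p ∈ P, algebraMap R K p * x ∈ (algebraMap R K).range)
    (hTP : ∀ x, (∀ p ∈ P, algebraMap R K p * x ∈ T) → x ∈ T) {a : R} (ha0 : a ≠ 0) :
    ∃ c ∈ P, ∀ y, algebraMap R K a * y ∈ T → algebraMap R K c * y ∈ T → y ∈ T := by
  classical
  have haK : algebraMap R K a ≠ 0 := by
    rwa [Ne, map_eq_zero_iff _ (IsFractionRing.injective R K)]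
  -- Writing `(T : y)` as `(R : Py)` shows that it is divisorial.
  let D : K → Ideal R := fun y => denominatorIdeal R {z | ∃ p ∈ P, z = algebraMap R K p * y}
  have hD : ∀ y r, r ∈ D y ↔ algebraMap R K r * y ∈ T := fun y r => by
    rw [hT]
    constructor
    · intro h p hp
      convert h _ ⟨p, hp, rfl⟩ using 1
      ring
    · rintro h _ ⟨p, hp, rfl⟩
      convert h p hp using 1
      ring
  let F : Set (Ideal R) := {I | ∃ y, y ∉ T ∧ algebraMap R K a * y ∈ T ∧ I = D y}
  have hF : ∀ I ∈ F, IsDivisorialIdeal K I := by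
    rintro _ ⟨y, -, -, rfl⟩
    exact isDivisorialIdeal_denominatorIdeal _
  let M : Set (Ideal R) := {I | I ∈ F ∧ ∀ J ∈ F, I ≤ J → J = I}
  have hprime : ∀ I ∈ M, I.IsPrime := by
    rintro I ⟨⟨y, hy, hay, rfl⟩, hmax⟩
    refine ⟨?_, ?_⟩
    · rw [Ideal.ne_top_iff_one, hD]
      simpa using hy
    · intro s t hst
      by_contra! h
      obtain ⟨hs, ht⟩ := h
      rw [hD] at ht hst
      refine hs ?_
      rw [← hmax (D (algebraMap R K t * y)) ⟨_, ht, ?_, rfl⟩ ?_, hD]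
      · simpa [mul_assoc] using hst
      · convert T.mul_mem (T.algebraMap_mem t) hay using 1
        ring
      · intro p hp
        rw [hD] at hp ⊢
        convert T.mul_mem (T.algebraMap_mem t) hp using 1
        ring
  -- `E s` is `(aR : ⋂ s)`, which grows with `s`; a maximal value shows that `M` is finite.
  let E : Finset (Ideal R) → Ideal R := fun s =>
    denominatorIdeal R {z | ∃ x ∈ s.inf id, z = algebraMap R K x / algebraMap R K a}
  obtain ⟨_, ⟨s, hsM, rfl⟩, -, hs⟩ := hMori.exists_maximal
    (F := {I | ∃ s : Finset (Ideal R), (∀ J ∈ s, J ∈ M) ∧ I = E s})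
    (by rintro _ ⟨s, -, rfl⟩; exact isDivisorialIdeal_denominatorIdeal _)
    ⟨∅, by simp, rfl⟩
  have hMs : ∀ Q ∈ M, Q ∈ s := by
    intro Q hQ
    have hle : s.inf id ≤ Q := by
      have hE : E (insert Q s) = E s := by
        refine hs _ ⟨insert Q s, ?_, rfl⟩ ?_
        · intro J hJ
          rcases Finset.mem_insert.mp hJ with rfl | hJ
          · exact hQ
          · exact hsM J hJ
        · rintro r hr _ ⟨x, hx, rfl⟩
          rw [Finset.inf_insert] at hx
          exact hr _ ⟨x, hx.2, rfl⟩
      obtain ⟨⟨y, hy, hay, rfl⟩, -⟩ := hQ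
      intro x hx
      rw [hD, hT]
      intro p hp
      obtain ⟨d, hd⟩ := (hT _).mp hay p hp
      have hdE : d ∈ E (insert (D y) s) := by
        rintro _ ⟨r, hr, rfl⟩
        rw [Finset.inf_insert] at hr
        have hr' := (hT _).mp ((hD y r).mp hr.1) p hp
        rw [hd]
        convert hr' using 1
        field_simp
      rw [hE] at hdE
      have := hdE _ ⟨x, hx, rfl⟩
      rw [hd] at this
      convert this using 1
      field_simp
    have := hprime Q hQ
    obtain ⟨J, hJ, hJQ⟩ := (Ideal.IsPrime.inf_le' this).mp hle
    rwa [(hsM J hJ).2 Q hQ.1 hJQ]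
  -- Prime avoidance: `P ⊆ (T : y)` would give `y ∈ (T : P) = T`.
  have hnot : ¬ (P : Set R) ⊆ ⋃ J ∈ (s : Set (Ideal R)), J := by
    intro h
    obtain ⟨J, hJ, hPJ⟩ := (Ideal.subset_union_prime (f := fun J : Ideal R => J) ⊥ ⊥
      fun J hJ _ _ => hprime J (hsM J hJ)).mp h
    obtain ⟨⟨y, hy, -, rfl⟩, -⟩ := hsM J hJ
    exact hy (hTP y fun p hp => (hD y p).mp (hPJ hp))
  obtain ⟨c, hcP, hc⟩ := Set.not_subset.mp hnot
  refine ⟨c, hcP, fun y hay hcy => ?_⟩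
  by_contra hy
  obtain ⟨J, hJF, hJ, hmax⟩ := hMori.exists_maximal hF ⟨y, hy, hay, rfl⟩
  refine hc (Set.mem_biUnion (Finset.mem_coe.mpr (hMs J ⟨hJF, hmax⟩)) ?_)
  exact hJ ((hD y c).mpr hcy)

/-- A Mori sQQR-domain is integrally closed. -/
theorem IsMoriDomain.mem_range_of_isIntegral (hMori : IsMoriDomain R K)
    (hR : IsSQQRDomain R K) {x : K} (hx : IsIntegral R x) : x ∈ (algebraMap R K).range := by
  by_contra hxR
  obtain ⟨u, hu, hP⟩ := hMori.exists_prime_denominatorIdeal hx hxR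
  set P := denominatorIdeal R {u} with hPdef
  have hPu : ∀ r, r ∈ P ↔ algebraMap R K r * u ∈ (algebraMap R K).range := fun r => by
    simp [hPdef, mem_denominatorIdeal]
  have huP : ∀ s ∉ P, algebraMap R K s * u ∉ (algebraMap R K).range := fun s hs => by
    rwa [← hPu]
  have huR : u ∉ (algebraMap R K).range := fun h =>
    hP.ne_top ((Ideal.eq_top_iff_one _).mpr ((hPu 1).mpr (by simpa using h)))
  set T := Algebra.adjoin R {u}
  have hTint : ∀ t ∈ T, IsIntegral R t := fun t ht =>
    Algebra.adjoin_le (S := integralClosure R K) (by simpa [mem_integralClosure_iff] using hu) ht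
  have hsubT : ∀ t ∈ (algebraMap R K).range, t ∈ T := by
    rintro _ ⟨r, rfl⟩
    exact T.algebraMap_mem r
  have hPT : ∀ t ∈ T, ∀ p ∈ P, ∃ q ∈ P, algebraMap R K q = algebraMap R K p * t := by
    intro t ht
    induction ht using Algebra.adjoin_induction with
    | mem t ht =>
      rw [Set.mem_singleton_iff.mp ht]
      intro p hp
      obtain ⟨q, hq⟩ := (hPu p).mp hp
      exact ⟨q, mem_of_isIntegral_mul hp hu hq.symm, hq⟩
    | algebraMap r => exact fun p hp => ⟨p * r, P.mul_mem_right r hp, map_mul _ _ _⟩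
    | add s t _ _ hs ht =>
      intro p hp
      obtain ⟨q, hq, hq'⟩ := hs p hp
      obtain ⟨q₂, hq₂, hq₂'⟩ := ht p hp
      exact ⟨q + q₂, add_mem hq hq₂, by rw [map_add, hq', hq₂', mul_add]⟩
    | mul s t _ _ hs ht =>
      intro p hp
      obtain ⟨q, hq, hq'⟩ := hs p hp
      obtain ⟨q₂, hq₂, hq₂'⟩ := ht q hq
      exact ⟨q₂, hq₂, by rw [hq₂', hq', mul_assoc]⟩
  have hTP : ∀ x, (∀ p ∈ P, algebraMap R K p * x ∈ T) → x ∈ T := fun x => hR.mem_adjoin huP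
  have hT : ∀ x, x ∈ T ↔ ∀ p ∈ P, algebraMap R K p * x ∈ (algebraMap R K).range := fun x =>
    ⟨fun h p hp => let ⟨q, _, hq⟩ := hPT x h p hp; ⟨q, hq⟩,
      fun h => hTP x fun p hp => hsubT _ (h p hp)⟩
  obtain ⟨b, a, ha0, hba⟩ := IsFractionRing.div_surjective (A := R) u
  have ha0 : a ≠ 0 := nonZeroDivisors.ne_zero ha0
  have haK : algebraMap R K a ≠ 0 := by
    rwa [Ne, map_eq_zero_iff _ (IsFractionRing.injective R K)]
  have haP : a ∈ P := (hPu a).mpr ⟨b, by rw [← hba]; field_simp⟩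
  obtain ⟨c, hcP, hc⟩ := hMori.exists_regular_pair hT hTP ha0
  set w := algebraMap R K c / algebraMap R K a with hw
  have hwP : ∀ s ∉ P, algebraMap R K s * w ∉ (algebraMap R K).range := by
    intro s hs hsw
    have hz : algebraMap R K s / algebraMap R K a ∈ T := by
      refine hc _ ?_ ?_
      · rw [mul_div_cancel₀ _ haK]
        exact T.algebraMap_mem s
      · refine hsubT _ ?_
        convert hsw using 1
        rw [hw]
        ring
    exact hs (mem_of_isIntegral_mul haP (hTint _ hz) (mul_div_cancel₀ _ haK))
  have huw : u ∈ Algebra.adjoin R {w} := hR.mem_adjoin hwP fun p hp => by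
    obtain ⟨q, hq⟩ := (hPu p).mp hp
    rw [← hq]
    exact Subalgebra.algebraMap_mem _ q
  rw [Algebra.adjoin_singleton_eq_range_aeval] at huw
  obtain ⟨f, hf⟩ := huw
  have hf' : u - algebraMap R K (f.coeff 0) = w * aeval w f.divX := by
    have h := congrArg (aeval w) (divX_mul_X_add f)
    rw [map_add, map_mul, aeval_X, aeval_C] at h
    rw [← hf]
    change aeval w f - _ = _
    rw [← h]
    ring
  have hcK : algebraMap R K c ≠ 0 := fun h =>
    hwP 1 ((Ideal.ne_top_iff_one _).mp hP.ne_top) (by simp [hw, h, zero_mem])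
  set y := aeval w f.divX / algebraMap R K a with hy
  have hcy : algebraMap R K c * y = u - algebraMap R K (f.coeff 0) := by
    rw [hf', hy, hw]
    ring
  have hcyT : algebraMap R K c * y ∈ T := by
    rw [hcy]
    exact sub_mem (Algebra.self_mem_adjoin_singleton R u) (T.algebraMap_mem _)
  -- As `cy ∈ T`, regularity of `c` modulo `aT` strips off one power of `a` at a time.
  have hdesc : ∀ n : ℕ, algebraMap R K a ^ n * y ∈ T → y ∈ T := by
    intro n
    induction n with
    | zero => simp
    | succ n ih =>
      intro h
      refine ih (hc _ ?_ ?_)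
      · convert h using 1
        ring
      · convert T.mul_mem (T.pow_mem (T.algebraMap_mem a) n) hcyT using 1
        ring
  have hyT : y ∈ T := by
    refine hdesc (f.divX.natDegree + 1) (hsubT _ ?_)
    convert pow_natDegree_mul_aeval_div_mem_range haK f.divX using 1
    rw [hy, pow_succ, mul_assoc, mul_div_cancel₀ _ haK]
  obtain ⟨q, -, hq⟩ := hPT y hyT c hcP
  refine huR ⟨q + f.coeff 0, ?_⟩
  rw [map_add, hq, hcy]
  ring

end IntegrallyClosed

/-! ### Invertibility of finitely generated ideals. -/

section Pruefer

variable {R : Type*} [CommRing R] [IsDomain R] {K : Type*} [Field K] [Algebra R K]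
  [IsFractionRing R K]

/-- Any `R_Q` containing `w²` contains `w`, being integrally closed. -/
theorem IsSQQRDomain.mem_adjoin_sq (hR : IsSQQRDomain R K)
    (hint : ∀ x : K, IsIntegral R x → x ∈ (algebraMap R K).range) (w : K) :
    w ∈ Algebra.adjoin R {w ^ 2} := by
  obtain ⟨S, hS⟩ := hR (w ^ 2)
  have hw : w ^ 2 ∈ Algebra.adjoin R {w ^ 2} := Algebra.self_mem_adjoin_singleton R _
  rw [hS] at hw ⊢
  simp only [Algebra.mem_iInf] at hw ⊢
  intro Q hQ
  obtain ⟨s, hs, b, hb⟩ := mem_localizationIn.mp (hw Q hQ)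
  refine mem_localizationIn.mpr ⟨s, hs, hint _ (IsIntegral.of_pow two_pos ?_)⟩
  have : (algebraMap R K s * w) ^ 2 = algebraMap R K (s * b) := by
    rw [map_mul, hb]
    ring
  rw [this]
  exact isIntegral_algebraMap

theorem IsSQQRDomain.exists_notMem_mul_eq (hR : IsSQQRDomain R K)
    (hint : ∀ x : K, IsIntegral R x → x ∈ (algebraMap R K).range) (M : Ideal R) [M.IsPrime]
    (x y : R) : ∃ s ∉ M, y ∣ s * x ∨ x ∣ s * y := by
  have h1M : (1 : R) ∉ M := (Ideal.ne_top_iff_one _).mp (Ideal.IsPrime.ne_top ‹_›)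
  by_cases hy : y = 0
  · exact ⟨1, h1M, Or.inr (by simp [hy])⟩
  have hyK : algebraMap R K y ≠ 0 := by
    rwa [Ne, map_eq_zero_iff _ (IsFractionRing.injective R K)]
  set w := algebraMap R K x / algebraMap R K y with hw
  have hmem := hR.mem_adjoin_sq hint w
  rw [Algebra.adjoin_singleton_eq_range_aeval] at hmem
  obtain ⟨q, hq⟩ := hmem
  obtain ⟨s, hs, b, h⟩ := exists_notMem_mul_eq_of_aeval_eq_zero hint M w _
    -- From `w = q(w²)`; only even powers are subtracted, so the coefficient of `X` is `1 ∉ M`.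
    (X - expand R 2 q) le_rfl (by
      rw [map_sub, aeval_X, expand_aeval]
      exact sub_eq_zero.mpr hq.symm) 1 (by simpa [coeff_expand] using h1M)
  refine ⟨s, hs, h.imp (fun h => ⟨b, ?_⟩) fun h => ⟨b, ?_⟩⟩ <;>
    apply IsFractionRing.injective R K
  · rw [map_mul, map_mul, ← h, hw]
    field_simp
  · rw [map_mul, map_mul, ← h, hw]
    field_simp

/-- Finitely generated ideals are locally principal. -/
theorem IsSQQRDomain.exists_locally_dvd (hR : IsSQQRDomain R K)
    (hint : ∀ x : K, IsIntegral R x → x ∈ (algebraMap R K).range) (M : Ideal R) [M.IsPrime]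
    (F : Finset R) (hF : F.Nonempty) : ∃ a ∈ F, ∃ s ∉ M, ∀ x ∈ F, a ∣ s * x := by
  classical
  induction hF using Finset.Nonempty.cons_induction with
  | singleton a =>
    exact ⟨a, by simp, 1, (Ideal.ne_top_iff_one _).mp (Ideal.IsPrime.ne_top ‹_›), by simp⟩
  | cons z F hz hF ih =>
    obtain ⟨a, haF, s, hs, h⟩ := ih
    obtain ⟨t, ht, hat | hzt⟩ := hR.exists_notMem_mul_eq hint M z a
    · refine ⟨a, by simp [haF], s * t, fun h => (Ideal.IsPrime.mem_or_mem ‹_› h).elim hs ht, ?_⟩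
      intro x hx
      rcases Finset.mem_cons.mp hx with rfl | hx
      · rw [mul_assoc]
        exact hat.mul_left s
      · rw [mul_comm s t, mul_assoc]
        exact (h x hx).mul_left t
    · refine ⟨z, by simp, t * s, fun h => (Ideal.IsPrime.mem_or_mem ‹_› h).elim ht hs, ?_⟩
      intro x hx
      rcases Finset.mem_cons.mp hx with rfl | hx
      · exact dvd_mul_left _ _
      · rw [mul_assoc]
        exact hzt.trans (mul_dvd_mul_left t (h x hx))

/-- If `a` generates `J` at `M`, then `sJ ⊆ aR` for some `s ∉ M`; so `s/a ∈ J⁻¹` and `s ∈ JJ⁻¹`,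
whence `JJ⁻¹` lies in no maximal ideal. -/
theorem IsSQQRDomain.mul_inv_eq_one_of_fg (hR : IsSQQRDomain R K)
    (hint : ∀ x : K, IsIntegral R x → x ∈ (algebraMap R K).range) {J : Ideal R} (hJ : J.FG)
    (hJ0 : J ≠ ⊥) : (J : FractionalIdeal R⁰ K) * (J : FractionalIdeal R⁰ K)⁻¹ = 1 := by
  obtain ⟨F, rfl⟩ := hJ
  have h0 : ((Ideal.span (F : Set R) : Ideal R) : FractionalIdeal R⁰ K) ≠ 0 :=
    FractionalIdeal.coeIdeal_ne_zero.mpr hJ0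
  have hle := FractionalIdeal.mul_one_div_le_one
    (I := ((Ideal.span (F : Set R) : Ideal R) : FractionalIdeal R⁰ K))
  rw [← FractionalIdeal.inv_eq] at hle
  obtain ⟨N, hN⟩ := FractionalIdeal.le_one_iff_exists_coeIdeal.mp hle
  rw [← hN]
  by_cases hNtop : N = ⊤
  · simp [hNtop]
  exfalso
  obtain ⟨M, hM, hNM⟩ := Ideal.exists_le_maximal N hNtop
  have hFne : F.Nonempty := by
    rw [Finset.nonempty_iff_ne_empty]
    rintro rfl
    simp at hJ0
  obtain ⟨a, haF, s, hs, h⟩ := hR.exists_locally_dvd hint M F hFne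
  have ha0 : a ≠ 0 := by
    rintro rfl
    refine hJ0 (Ideal.span_eq_bot.mpr fun x hx => ?_)
    have hs0 : s ≠ 0 := fun h => hs (h ▸ zero_mem _)
    simpa [hs0] using h x hx
  have haK : algebraMap R K a ≠ 0 := by
    rwa [Ne, map_eq_zero_iff _ (IsFractionRing.injective R K)]
  have hspan : ∀ x ∈ Ideal.span (F : Set R), a ∣ s * x := by
    intro x hx
    induction hx using Submodule.span_induction with
    | mem x hx => exact h x hx
    | zero => simp
    | add x y _ _ hx hy => rw [mul_add]; exact dvd_add hx hy
    | smul r x _ hx => rw [smul_eq_mul, mul_left_comm]; exact hx.mul_left r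
  have hinv : algebraMap R K s / algebraMap R K a ∈
      ((Ideal.span (F : Set R) : Ideal R) : FractionalIdeal R⁰ K)⁻¹ := by
    rw [FractionalIdeal.mem_inv_iff h0]
    intro y hy
    obtain ⟨x, hx, rfl⟩ := (FractionalIdeal.mem_coeIdeal _).mp hy
    obtain ⟨b, hb⟩ := hspan x hx
    refine (FractionalIdeal.mem_one_iff _).mpr ⟨b, ?_⟩
    rw [div_mul_eq_mul_div, ← map_mul, hb, map_mul]
    field_simp
  have hmem := FractionalIdeal.mul_mem_mul (FractionalIdeal.mem_coeIdeal_of_mem (S := R⁰)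
    (P := K) (Ideal.subset_span haF : a ∈ Ideal.span (F : Set R))) hinv
  rw [mul_div_cancel₀ _ haK, ← hN] at hmem
  obtain ⟨s', hs', he⟩ := (FractionalIdeal.mem_coeIdeal _).mp hmem
  rw [IsFractionRing.injective R K he] at hs'
  exact hs (hNM hs')

end Pruefer

/-! ### Noetherianity and the conclusion. -/

theorem theorem2p14 {R : Type*} [CommRing R] [IsDomain R] {K : Type*} [Field K] [Algebra R K]
    [IsFractionRing R K] (hMori : IsMoriDomain R K) (hsQQR : IsSQQRDomain R K) :
    IsDedekindDomain R := by
  have hint : ∀ x : K, IsIntegral R x → x ∈ (algebraMap R K).range := fun x hx =>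
    hMori.mem_range_of_isIntegral hsQQR hx
  have hdiv : ∀ J : Ideal R, J.FG → IsDivisorialIdeal K J := by
    intro J hJ
    by_cases hJ0 : J = ⊥
    · simp [IsDivisorialIdeal, hJ0, FractionalIdeal.inv_zero']
    · refine (FractionalIdeal.right_inverse_eq K _ _ ?_).symm
      rw [mul_comm]
      exact hsQQR.mul_inv_eq_one_of_fg hint hJ hJ0
  have hfg : ∀ I : Ideal R, I.FG := by
    intro I
    obtain ⟨J, ⟨hJ, hJI⟩, -, hmax⟩ := hMori.exists_maximal
      (F := {J : Ideal R | J.FG ∧ J ≤ I}) (fun J hJ => hdiv J hJ.1)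
      (I := ⊥) ⟨Submodule.fg_bot, bot_le⟩
    suffices J = I from this ▸ hJ
    refine le_antisymm hJI fun x hx => ?_
    have hxI : Ideal.span {x} ≤ I := (Ideal.span_singleton_le_iff_mem I).mpr hx
    rw [← hmax (J ⊔ Ideal.span {x}) ⟨Submodule.FG.sup hJ (Submodule.fg_span_singleton x), sup_le hJI hxI⟩
      le_sup_left]
    exact Ideal.mem_sup_right (Ideal.mem_span_singleton_self x)
  refine (isDedekindDomain_iff_mul_inv_cancel (K := K)).mpr ?_
  intro I hI
  obtain ⟨a, J, ha, rfl⟩ := FractionalIdeal.exists_eq_spanSingleton_mul I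
  have haK : algebraMap R K a ≠ 0 := by
    rwa [Ne, map_eq_zero_iff _ (IsFractionRing.injective R K)]
  have hJ0 : J ≠ ⊥ := by
    rintro rfl
    simp at hI
  refine (FractionalIdeal.mul_inv_cancel_iff K).mpr
    ⟨FractionalIdeal.spanSingleton R⁰ (algebraMap R K a) * (J : FractionalIdeal R⁰ K)⁻¹, ?_⟩
  rw [mul_mul_mul_comm, hsQQR.mul_inv_eq_one_of_fg hint (hfg J) hJ0,
    FractionalIdeal.spanSingleton_mul_spanSingleton, inv_mul_cancel₀ haK,
    FractionalIdeal.spanSingleton_one, one_mul]
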